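/- \textbf{Theorem.} Let $k$ be a field and $\mathsf E$ a small $k$-linear category. Write $x\preceq y$ if there is a chain of objects $x=z_0,z_1,\dots,z_n=y$ with $n\ge1$ and $\operatorname{Hom}_{\mathsf E}(z_{i-1},z_i)\ne0$ for all $1\le i\le n$, and $x\prec y$ if $x\preceq y$ and $y\not\preceq x$. Assume that $\mathsf E$ is \emph{left strictly locally finite}, that is: (i) $\operatorname{Hom}_{\mathsf E}(x,y)$ is finite-dimensional for all objects $x,y$; (ii) the set $\{z\in\mathsf E\mid x\preceq z\preceq y\}$ is finite for all objects $x,y$; (iii) for every object $y$ there is a finite set $X_y$ of objects $x\prec y$ such that every morphism $f\colon z\to y$ with $z\prec y$ can be written as a finite sum $f=\sum_{i=1}^n h_ig_i$, $n\ge0$, with $g_i\colon z\to x_i$, $h_i\colon x_i\to y$ and $x_i\in X_y$. Let $\mathcal C_{\mathsf E}=\bigoplus_{x,y\in\mathsf E}\operatorname{Hom}_{\mathsf E}(x,y)^*$ be the coalgebra over $k$ whose comultiplication has as components $\operatorname{Hom}_{\mathsf E}(x,y)^*\to\operatorname{Hom}_{\mathsf E}(x,z)^*\otimes_k\operatorname{Hom}_{\mathsf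 E}(z,y)^*$, $x\preceq z\preceq y$, the maps dual to the composition maps, and whose counit is evaluation at $\mathrm{id}_x$ on $\operatorname{Hom}_{\mathsf E}(x,x)^*$ and zero on $\operatorname{Hom}_{\mathsf E}(x,y)^*$ for $x\neq y$. A left $\mathcal C_{\mathsf E}$-contramodule is a $k$-vector space $\mathfrak P$ with a linear map $\pi\colon\operatorname{Hom}_k(\mathcal C_{\mathsf E},\mathfrak P)\to\mathfrak P$ satisfying contraassociativity and contraunitality, where $\operatorname{Hom}_k(\mathcal C_{\mathsf E},\operatorname{Hom}_k(\mathcal C_{\mathsf E},\mathfrak P))$ is identified with $\operatorname{Hom}_k(\mathcal C_{\mathsf E}\otimes_k\mathcal C_{\mathsf E},\mathfrak P)$ via $\varphi\mapsto(a\otimes b\mapsto\varphi(b)(a))$. For a morphism $f\colon x\to y$ of $\mathsf E$ let $f$ act on $\mathfrak P$ by $p\mapsto\pi(c\mapsto c_{x,y}(f)\,p)$, where $c_{x,y}$ is the component of $c$ in $\operatorname{Hom}_{\mathsf E}(x,y)^*$; let $\mathfrak P^x$ be the image of the idempotent operator given by $\mathrm{id}_x$. The contramodule forgetful functor $\Theta_{\mathsf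 E}$ from left $\mathcal C_{\mathsf E}$-contramodules to left $\mathsf E$-modules (covariant $k$-linear functors from $\mathsf E$ to $k$-vector spaces) sends $\mathfrak P$ to the $\mathsf E$-module $x\mapsto\mathfrak P^x$ with this action. Let $P$ be a left $\mathsf E$-module such that $P(x)$ is finite-dimensional for every object $x$. Then $P$ lies in the essential image of $\Theta_{\mathsf E}$ (that is, $P\simeq\Theta_{\mathsf E}(\mathfrak P)$ for some left $\mathcal C_{\mathsf E}$-contramodule $\mathfrak P$) if and only if, for every object $y\in\mathsf E$, the set of all objects $x\in\mathsf E$ for which the action map $\operatorname{Hom}_{\mathsf E}(x,y)\otimes_kP(x)\to P(y)$ is nonzero is finite. -/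

import Mathlib

open CategoryTheory TensorProduct

universe w u v t

namespace LocFin

noncomputable section

/-! ### The preorder on objects and (left strictly) locally finite `k`-linear categories -/

section Preorder

variable {E : Type u} [Category.{v} E] [Preadditive E]

/-- `x ≼ y`: there is a chain `x = z₀, z₁, …, zₙ = y` with `n ≥ 1` and `Hom(zᵢ₋₁, zᵢ) ≠ 0`. -/
def Le (x y : E) : Prop :=
  Relation.TransGen (fun a b : E => ∃ f : a ⟶ b, f ≠ 0) x y

/-- `x ≺ y`: `x ≼ y` and not `y ≼ x`. -/
def Lt (x y : E) : Prop := Le x y ∧ ¬ Le y x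

end Preorder

/-- A `k`-linear category is locally finite if its Hom spaces are finite-dimensional and the
intervals `{z | x ≼ z ≼ y}` are finite. -/
class IsLocallyFinite (k : Type w) [Field k] (E : Type u) [Category.{v} E] [Preadditive E]
    [Linear k E] : Prop where
  finite_hom : ∀ x y : E, Module.Finite k (x ⟶ y)
  finite_interval : ∀ x y : E, {z : E | Le x z ∧ Le z y}.Finite

/-- A locally finite `k`-linear category is left strictly locally finite if every object `y`
admits a finite set `X` of objects `≺ y` such that every morphism `z ⟶ y` with `z ≺ y` is a
finite sum of composites `z ⟶ xᵢ ⟶ y` with `xᵢ ∈ X`. -/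
class IsLeftStrictlyLocallyFinite (k : Type w) [Field k] (E : Type u) [Category.{v} E]
    [Preadditive E] [Linear k E] : Prop extends IsLocallyFinite k E where
  exists_frontier : ∀ y : E, ∃ X : Finset E, (∀ x ∈ X, Lt x y) ∧
    ∀ (z : E) (f : z ⟶ y), Lt z y →
      ∃ (n : ℕ) (x : Fin n → E) (g : ∀ i, z ⟶ x i) (h : ∀ i, x i ⟶ y),
        (∀ i, x i ∈ X) ∧ f = ∑ i, g i ≫ h i

/-! ### Left contramodules over a coalgebra -/

/-- A left contramodule over a coalgebra `C` over a field `k`: a vector space `P` with a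
contraaction map `π : Hom(C, P) → P`.  In contraassociativity, the identification
`Hom(C, Hom(C, P)) ≃ Hom(C ⊗ C, P)` sends `φ` to `a ⊗ b ↦ φ b a` (the convention for *left*
contramodules). -/
structure Contramodule (k : Type w) [Field k] (C : Type u) [AddCommGroup C] [Module k C]
    [Coalgebra k C] where
  carrier : Type t
  [addCommGroup : AddCommGroup carrier]
  [module : Module k carrier]
  π : (C →ₗ[k] carrier) →ₗ[k] carrier
  contraassoc : ∀ φ : C →ₗ[k] C →ₗ[k] carrier,
    π (π ∘ₗ φ) = π (TensorProduct.lift φ.flip ∘ₗ Coalgebra.comul)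
  contraunit : ∀ p : carrier, π ((Coalgebra.counit : C →ₗ[k] k).smulRight p) = p

namespace Contramodule

variable {k : Type w} [Field k] {C : Type u} [AddCommGroup C] [Module k C] [Coalgebra k C]

instance : CoeSort (Contramodule.{w, u, t} k C) (Type t) := ⟨carrier⟩

attribute [instance] addCommGroup module

/-- Morphisms of contramodules: linear maps commuting with the contraactions. -/
@[ext]
structure Hom (P Q : Contramodule.{w, u, t} k C) where
  toLinearMap : P →ₗ[k] Q
  comm : ∀ φ : C →ₗ[k] P, toLinearMap (P.π φ) = Q.π (toLinearMap ∘ₗ φ)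

instance : Category (Contramodule.{w, u, t} k C) where
  Hom P Q := Hom P Q
  id P := ⟨LinearMap.id, fun _ => rfl⟩
  comp f g := ⟨g.toLinearMap ∘ₗ f.toLinearMap, fun φ => by
    simp only [LinearMap.comp_apply, f.comm, g.comm, LinearMap.comp_assoc]⟩

/-- The action on a left contramodule of a linear function `α` on the coalgebra. -/
def dualAct (P : Contramodule.{w, u, t} k C) (α : Module.Dual k C) : P →ₗ[k] P where
  toFun p := P.π (α.smulRight p)
  map_add' p q := by
    rw [← map_add]; congr 1; ext c; simp
  map_smul' r p := by
    rw [RingHom.id_apply, ← map_smul]; congr 1; ext c; simp [smul_smul, mul_comm]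

end Contramodule

/-! ### The coalgebra of a locally finite `k`-linear category -/

/-- The underlying vector space `⨁_{x,y} Hom(x,y)^*` of the coalgebra of `E`; the component
with index `(x, y)` is `Hom(x,y)^*`. -/
def CatCoalg (k : Type w) [Field k] (E : Type u) [Category.{v} E] [Preadditive E]
    [Linear k E] : Type (max u v w) :=
  DirectSum (E × E) (fun p => Module.Dual k (p.1 ⟶ p.2))

namespace CatCoalg

section Basic

variable (k : Type w) [Field k] (E : Type u) [Category.{v} E] [Preadditive E] [Linear k E]

instance : AddCommGroup (CatCoalg k E) :=
  inferInstanceAs (AddCommGroup (DirectSum (E × E) (fun p => Module.Dual k (p.1 ⟶ p.2))))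

instance : Module k (CatCoalg k E) :=
  inferInstanceAs (Module k (DirectSum (E × E) (fun p => Module.Dual k (p.1 ⟶ p.2))))

/-- The identity map, from the coalgebra to the direct sum that it is by definition. -/
def toDirectSum : CatCoalg k E ≃ₗ[k] DirectSum (E × E) (fun p => Module.Dual k (p.1 ⟶ p.2)) :=
  LinearEquiv.refl k (DirectSum (E × E) (fun p => Module.Dual k (p.1 ⟶ p.2)))

variable {E}

open scoped Classical in
/-- The inclusion of the direct summand `Hom(x,y)^*`. -/
def incl (x y : E) : Module.Dual k (x ⟶ y) →ₗ[k] CatCoalg k E :=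
  (toDirectSum k E).symm.toLinearMap ∘ₗ
    DirectSum.lof k (E × E) (fun p => Module.Dual k (p.1 ⟶ p.2)) (x, y)

/-- Evaluation at a morphism `f : x ⟶ y`: the projection onto `Hom(x,y)^*` followed by
the pairing with `f`. -/
def ev {x y : E} (f : x ⟶ y) : Module.Dual k (CatCoalg k E) :=
  Module.Dual.eval k (x ⟶ y) f ∘ₗ
    DirectSum.component k (E × E) (fun p => Module.Dual k (p.1 ⟶ p.2)) (x, y) ∘ₗ
    (toDirectSum k E).toLinearMap

variable (E)

open scoped Classical in
/-- The counit: zero on `Hom(x,y)^*` for `x ≠ y`, evaluation at `𝟙 x` on `Hom(x,x)^*`. -/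
def counit : CatCoalg k E →ₗ[k] k :=
  (DirectSum.toModule k (E × E) k fun p =>
    if h : p.1 = p.2 then Module.Dual.eval k (p.1 ⟶ p.2) (eqToHom h) else 0) ∘ₗ
    (toDirectSum k E).toLinearMap

variable {E}

/-- The composition map `Hom(x,z) ⊗ Hom(z,y) → Hom(x,y)`. -/
def compMap (x z y : E) : (x ⟶ z) ⊗[k] (z ⟶ y) →ₗ[k] (x ⟶ y) :=
  TensorProduct.lift (Linear.comp x z y)

variable [IsLocallyFinite k E]

instance (x y : E) : Module.Finite k (x ⟶ y) := IsLocallyFinite.finite_hom x y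

/-- The component `Hom(x,y)^* → Hom(x,z)^* ⊗ Hom(z,y)^*` of the comultiplication, dual to the
composition map. -/
def comulComponent (x z y : E) :
    Module.Dual k (x ⟶ y) →ₗ[k] Module.Dual k (x ⟶ z) ⊗[k] Module.Dual k (z ⟶ y) :=
  (TensorProduct.dualDistribEquiv k (x ⟶ z) (z ⟶ y)).symm.toLinearMap ∘ₗ
    (compMap k x z y).dualMap

variable (E)

open scoped Classical in
/-- The comultiplication: on `Hom(x,y)^*` it is the sum of the components
`Hom(x,y)^* → Hom(x,z)^* ⊗ Hom(z,y)^*` over the finite set of all `z` with `x ≼ z ≼ y`. -/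
def comul : CatCoalg k E →ₗ[k] CatCoalg k E ⊗[k] CatCoalg k E :=
  (DirectSum.toModule k (E × E) _ fun p =>
    ∑ z ∈ (IsLocallyFinite.finite_interval k p.1 p.2).toFinset,
      TensorProduct.map (incl k p.1 z) (incl k z p.2) ∘ₗ comulComponent k p.1 z p.2) ∘ₗ
    (toDirectSum k E).toLinearMap

end Basic

/-! The coalgebra axioms. -/

section Axioms

variable {k : Type w} [Field k]

theorem eq_zero_of_rTensor {V : Type*} {W : Type*} [AddCommGroup V] [AddCommGroup W]
    [Module k V] [Module k W] {ι : Type*} (F : ι → Module.Dual k V)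
    (hF : ∀ v, (∀ i, F i v = 0) → v = 0) (s : V ⊗[k] W)
    (hs : ∀ i, (F i).rTensor W s = 0) : s = 0 := by
  classical
  let b := Module.Basis.ofVectorSpace k W
  apply (TensorProduct.equivFinsuppOfBasisRight b).injective
  rw [map_zero]
  ext j
  refine hF _ fun i => ?_
  have key : ∀ s : V ⊗[k] W, F i (TensorProduct.equivFinsuppOfBasisRight b s j) =
      TensorProduct.equivFinsuppOfBasisRight b ((F i).rTensor W s) j := by
    intro s
    induction s with
    | zero => simp
    | add a b ha hb => simp [ha, hb]
    | tmul a b => simp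
  rw [key, hs]; simp

theorem eq_zero_of_dualDistrib {V : Type*} {W : Type*} [AddCommGroup V] [AddCommGroup W]
    [Module k V] [Module k W] {ι κ : Type*} (F : ι → Module.Dual k V) (G : κ → Module.Dual k W)
    (hF : ∀ v, (∀ i, F i v = 0) → v = 0) (hG : ∀ v, (∀ i, G i v = 0) → v = 0) (s : V ⊗[k] W)
    (hs : ∀ i j, TensorProduct.dualDistrib k V W (F i ⊗ₜ G j) s = 0) : s = 0 := by
  refine eq_zero_of_rTensor F hF s fun i => ?_
  apply (TensorProduct.lid k W).injective
  rw [map_zero]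
  refine hG _ fun j => ?_
  rw [← hs i j]
  clear hs
  induction s with
  | zero => simp
  | add a b ha hb => simp [ha, hb]
  | tmul a b => simp

variable {E : Type u} [Category.{v} E] [Preadditive E] [Linear k E]

theorem hom_ext' {M : Type*} [AddCommGroup M] [Module k M] {α β : CatCoalg k E →ₗ[k] M}
    (h : ∀ (x y : E) (φ : Module.Dual k (x ⟶ y)), α (incl k x y φ) = β (incl k x y φ)) :
    α = β := by
  classical
  suffices hs : α ∘ₗ (toDirectSum k E).symm.toLinearMap =
      β ∘ₗ (toDirectSum k E).symm.toLinearMap by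
    refine LinearMap.ext fun c => ?_
    simpa using LinearMap.congr_fun hs (toDirectSum k E c)
  refine DirectSum.linearMap_ext k fun p => LinearMap.ext fun φ => ?_
  have := h p.1 p.2 φ
  unfold incl at this
  convert this using 1
  all_goals simp only [LinearMap.comp_apply]

theorem ev_incl {x y : E} (f : x ⟶ y) (φ : Module.Dual k (x ⟶ y)) :
    ev k f (incl k x y φ) = φ f := by
  classical
  have : DirectSum.component k (E × E) (fun p => Module.Dual k (p.1 ⟶ p.2)) (x, y)
      (toDirectSum k E (incl k x y φ)) = φ := DirectSum.component.lof_self ..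
  simp only [ev, LinearMap.comp_apply, LinearEquiv.coe_coe, this, Module.Dual.eval_apply]

theorem ev_incl_ne {x y x' y' : E} (f : x ⟶ y) (φ : Module.Dual k (x' ⟶ y'))
    (h : ¬ (x' = x ∧ y' = y)) : ev k f (incl k x' y' φ) = 0 := by
  classical
  have : DirectSum.component k (E × E) (fun p => Module.Dual k (p.1 ⟶ p.2)) (x, y)
      (toDirectSum k E (incl k x' y' φ)) = 0 := by
    refine (DirectSum.component.of k (M := fun p : E × E => Module.Dual k (p.1 ⟶ p.2))
      (x, y) (x', y') φ).trans ?_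
    rw [dif_neg]
    simpa [Prod.ext_iff] using h
  simp only [ev, LinearMap.comp_apply, LinearEquiv.coe_coe, this, map_zero]

theorem ev_comp_incl {x y : E} (f : x ⟶ y) :
    ev k f ∘ₗ incl k x y = Module.Dual.eval k _ f := by
  ext φ; simp [ev_incl]

theorem ev_comp_incl_ne {x y x' y' : E} (f : x ⟶ y) (h : ¬ (x' = x ∧ y' = y)) :
    ev k f ∘ₗ incl k x' y' = 0 := by
  ext φ; simp [ev_incl_ne f φ h]

theorem eq_zero_of_ev (c : CatCoalg k E)
    (h : ∀ i : (p : E × E) × (p.1 ⟶ p.2), ev k i.2 c = 0) : c = 0 := by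
  refine DFinsupp.ext fun p => LinearMap.ext fun f => h ⟨p, f⟩

theorem counit_incl (x : E) (φ : Module.Dual k (x ⟶ x)) :
    counit k E (incl k x x φ) = φ (𝟙 x) := by
  classical
  unfold counit incl
  rw [LinearMap.comp_apply, LinearMap.comp_apply, LinearEquiv.coe_coe, LinearEquiv.coe_coe,
    LinearEquiv.apply_symm_apply, DirectSum.toModule_lof]
  simp

theorem counit_incl_ne {x y : E} (h : x ≠ y) (φ : Module.Dual k (x ⟶ y)) :
    counit k E (incl k x y φ) = 0 := by
  classical
  unfold counit incl
  rw [LinearMap.comp_apply, LinearMap.comp_apply, LinearEquiv.coe_coe, LinearEquiv.coe_coe,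
    LinearEquiv.apply_symm_apply, DirectSum.toModule_lof]
  simp [h]

variable [IsLocallyFinite k E]

open scoped Classical in
theorem comul_incl (x y : E) (φ : Module.Dual k (x ⟶ y)) :
    comul k E (incl k x y φ) = ∑ z ∈ (IsLocallyFinite.finite_interval k x y).toFinset,
      TensorProduct.map (incl k x z) (incl k z y) (comulComponent k x z y φ) := by
  unfold comul
  rw [incl, LinearMap.comp_apply, LinearMap.comp_apply, LinearEquiv.coe_coe,
    LinearEquiv.coe_coe, LinearEquiv.apply_symm_apply, DirectSum.toModule_lof]
  simp [LinearMap.sum_apply, incl]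

theorem dualDistrib_comulComponent {x z y : E} (f : x ⟶ z) (g : z ⟶ y)
    (φ : Module.Dual k (x ⟶ y)) :
    TensorProduct.dualDistrib k _ _
      (Module.Dual.eval k _ f ⊗ₜ Module.Dual.eval k _ g) (comulComponent k x z y φ) =
      φ (f ≫ g) := by
  have key : ∀ s : Module.Dual k (x ⟶ z) ⊗[k] Module.Dual k (z ⟶ y),
      TensorProduct.dualDistrib k _ _ (Module.Dual.eval k _ f ⊗ₜ Module.Dual.eval k _ g) s =
      TensorProduct.dualDistribEquiv k (x ⟶ z) (z ⟶ y) s (f ⊗ₜ g) := by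
    intro s
    induction s with
    | zero => simp
    | add a b ha hb => simp only [map_add, ha, hb, LinearMap.add_apply]
    | tmul a b =>
      simp only [TensorProduct.dualDistrib_apply, Module.Dual.eval_apply]
      exact (TensorProduct.dualDistrib_apply a b f g).symm
  rw [key, comulComponent, LinearMap.comp_apply, LinearEquiv.coe_coe,
    LinearEquiv.apply_symm_apply, LinearMap.dualMap_apply, compMap, TensorProduct.lift.tmul,
    Linear.comp_apply, Linear.leftComp_apply]

theorem dualDistrib_map {V W V' W' : Type*} [AddCommGroup V] [AddCommGroup W]
    [Module k V] [Module k W] [AddCommGroup V'] [AddCommGroup W']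
    [Module k V'] [Module k W'] (a : V →ₗ[k] V') (b : W →ₗ[k] W') (α : Module.Dual k V')
    (β : Module.Dual k W') (s : V ⊗[k] W) :
    TensorProduct.dualDistrib k _ _ (α ⊗ₜ β) (TensorProduct.map a b s) =
      TensorProduct.dualDistrib k _ _ ((α ∘ₗ a) ⊗ₜ (β ∘ₗ b)) s := by
  induction s with
  | zero => simp
  | add a b ha hb => simp only [map_add, ha, hb]
  | tmul a b => simp

theorem ev_ev_comul {x z y : E} (f : x ⟶ z) (g : z ⟶ y) (c : CatCoalg k E) :
    TensorProduct.dualDistrib k _ _ (ev k f ⊗ₜ ev k g) (comul k E c) = ev k (f ≫ g) c := by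
  classical
  suffices h : TensorProduct.dualDistrib k _ _ (ev k f ⊗ₜ ev k g) ∘ₗ comul k E =
      ev k (f ≫ g) from LinearMap.congr_fun h c
  refine hom_ext' fun x' y' φ => ?_
  rw [LinearMap.comp_apply, comul_incl, map_sum]
  simp only [dualDistrib_map]
  by_cases hx : x' = x
  · by_cases hy : y' = y
    · subst hx hy
      rw [ev_incl, Finset.sum_eq_single z]
      · rw [ev_comp_incl, ev_comp_incl, dualDistrib_comulComponent]
      · intro b _ hb
        rw [ev_comp_incl_ne f (by simpa using hb)]
        simp
      · intro hz
        rw [ev_comp_incl, ev_comp_incl, dualDistrib_comulComponent]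
        by_cases hf : f = 0
        · simp [hf]
        by_cases hg : g = 0
        · simp [hg]
        have hm : Le x' z ∧ Le z y' :=
          ⟨Relation.TransGen.single ⟨f, hf⟩, Relation.TransGen.single ⟨g, hg⟩⟩
        exact absurd ((Set.Finite.mem_toFinset (IsLocallyFinite.finite_interval k x' y')).2 hm) hz
    · rw [ev_incl_ne _ _ (by simp [hy])]
      refine Finset.sum_eq_zero fun b _ => ?_
      rw [ev_comp_incl_ne g (by simp [hy])]
      simp
  · rw [ev_incl_ne _ _ (by simp [hx])]
    refine Finset.sum_eq_zero fun b _ => ?_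
    rw [ev_comp_incl_ne f (by simp [hx])]
    simp

theorem ev_ev_comul_ne {x z z' y : E} (f : x ⟶ z) (g : z' ⟶ y) (hz : z ≠ z')
    (c : CatCoalg k E) :
    TensorProduct.dualDistrib k _ _ (ev k f ⊗ₜ ev k g) (comul k E c) = 0 := by
  classical
  suffices h : TensorProduct.dualDistrib k _ _ (ev k f ⊗ₜ ev k g) ∘ₗ comul k E = 0 from
    LinearMap.congr_fun h c
  refine hom_ext' fun x' y' φ => ?_
  rw [LinearMap.comp_apply, comul_incl, map_sum, LinearMap.zero_apply]
  simp only [dualDistrib_map]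
  refine Finset.sum_eq_zero fun b _ => ?_
  by_cases hb : b = z
  · rw [ev_comp_incl_ne g (by rintro ⟨h, -⟩; exact hz (hb.symm.trans h))]
    simp
  · rw [ev_comp_incl_ne f (by rintro ⟨-, h⟩; exact hb h)]
    simp

theorem dualDistrib_lTensor {V W W' : Type*} [AddCommGroup V] [AddCommGroup W]
    [Module k V] [Module k W] [AddCommGroup W'] [Module k W'] (b : W →ₗ[k] W')
    (α : Module.Dual k V) (β : Module.Dual k W') (s : V ⊗[k] W) :
    TensorProduct.dualDistrib k _ _ (α ⊗ₜ β) (b.lTensor V s) =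
      TensorProduct.dualDistrib k _ _ (α ⊗ₜ (β ∘ₗ b)) s :=
  dualDistrib_map _ _ _ _ _

theorem dualDistrib_assoc_rTensor {V W V₁ V₂ : Type*} [AddCommGroup V] [AddCommGroup W]
    [Module k V] [Module k W] [AddCommGroup V₁] [Module k V₁] [AddCommGroup V₂] [Module k V₂]
    (a : V →ₗ[k] V₁ ⊗[k] V₂)
    (α : Module.Dual k V₁) (β : Module.Dual k V₂) (γ : Module.Dual k W) (s : V ⊗[k] W) :
    TensorProduct.dualDistrib k _ _ (α ⊗ₜ (TensorProduct.dualDistrib k _ _ (β ⊗ₜ γ)))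
      (TensorProduct.assoc k V₁ V₂ W (a.rTensor W s)) =
      TensorProduct.dualDistrib k _ _
        (((TensorProduct.dualDistrib k _ _ (α ⊗ₜ β)) ∘ₗ a) ⊗ₜ γ) s := by
  induction s with
  | zero => simp
  | add a b ha hb => simp only [map_add, ha, hb]
  | tmul v w =>
    simp only [LinearMap.rTensor_tmul, TensorProduct.dualDistrib_apply, LinearMap.comp_apply]
    generalize a v = r
    induction r with
    | zero => simp
    | add a b ha hb => simp only [map_add, ha, hb, TensorProduct.add_tmul, add_mul]
    | tmul p q => simp [mul_assoc]

theorem comul_coassoc : TensorProduct.assoc k (CatCoalg k E) (CatCoalg k E) (CatCoalg k E) ∘ₗ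
    (comul k E).rTensor _ ∘ₗ comul k E = (comul k E).lTensor _ ∘ₗ comul k E := by
  refine LinearMap.ext fun c => ?_
  rw [← sub_eq_zero]
  let F : ((p : E × E) × (p.1 ⟶ p.2)) → Module.Dual k (CatCoalg k E) := fun i => ev k i.2
  refine eq_zero_of_dualDistrib F
    (fun ij : ((p : E × E) × (p.1 ⟶ p.2)) × ((p : E × E) × (p.1 ⟶ p.2)) =>
      TensorProduct.dualDistrib k _ _ (F ij.1 ⊗ₜ F ij.2)) eq_zero_of_ev
    (fun s hs => eq_zero_of_dualDistrib F F eq_zero_of_ev eq_zero_of_ev s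
      fun i j => hs (i, j)) _ ?_
  rintro ⟨⟨x, y⟩, f⟩ ⟨⟨⟨y', z⟩, g⟩, ⟨⟨z', w⟩, h⟩⟩
  simp only at f g h
  rw [map_sub, sub_eq_zero]
  simp only [F, LinearMap.comp_apply, LinearEquiv.coe_coe, dualDistrib_lTensor,
    dualDistrib_assoc_rTensor]
  have e0 : ∀ {x y z w : E} (f : x ⟶ y) (g : z ⟶ w), y ≠ z →
      TensorProduct.dualDistrib k _ _ (ev k f ⊗ₜ ev k g) ∘ₗ comul k E = 0 := fun f g hh =>
    LinearMap.ext fun c => ev_ev_comul_ne f g hh c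
  have e1 : ∀ {x y w : E} (f : x ⟶ y) (g : y ⟶ w),
      TensorProduct.dualDistrib k _ _ (ev k f ⊗ₜ ev k g) ∘ₗ comul k E = ev k (f ≫ g) :=
    fun f g => LinearMap.ext fun c => ev_ev_comul f g c
  by_cases hy : y = y'
  · subst hy
    by_cases hz : z = z'
    · subst hz
      rw [e1, e1, ev_ev_comul, ev_ev_comul, Category.assoc]
    · rw [e1, e0 g h hz, ev_ev_comul_ne _ _ hz]; simp
  · rw [e0 f g hy]
    by_cases hz : z = z'
    · subst hz
      rw [e1, ev_ev_comul_ne _ _ hy]; simp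
    · rw [e0 g h hz]; simp

theorem dualDistrib_counit_left {z w : E} (g : z ⟶ w) (c : CatCoalg k E) :
    TensorProduct.dualDistrib k _ _ (counit k E ⊗ₜ ev k g) (comul k E c) = ev k g c := by
  classical
  suffices h : TensorProduct.dualDistrib k _ _ (counit k E ⊗ₜ ev k g) ∘ₗ comul k E = ev k g from
    LinearMap.congr_fun h c
  refine hom_ext' fun x y φ => ?_
  rw [LinearMap.comp_apply, comul_incl, map_sum]
  simp only [dualDistrib_map]
  have hc : ∀ b, counit k E ∘ₗ incl k x b = ev k (𝟙 x) ∘ₗ incl k x b := by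
    intro b
    ext φ
    by_cases hb : x = b
    · subst hb; simp [counit_incl, ev_incl]
    · simp [counit_incl_ne hb, ev_incl_ne (𝟙 x) φ (by simpa using Ne.symm hb)]
  simp only [hc, ← dualDistrib_map]
  rw [← map_sum, ← comul_incl]
  by_cases hx : x = z
  · subst hx
    rw [ev_ev_comul, Category.id_comp]
  · rw [ev_ev_comul_ne _ _ hx, ev_incl_ne _ _ (by simp [hx])]

theorem dualDistrib_counit_right {z w : E} (g : z ⟶ w) (c : CatCoalg k E) :
    TensorProduct.dualDistrib k _ _ (ev k g ⊗ₜ counit k E) (comul k E c) = ev k g c := by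
  classical
  suffices h : TensorProduct.dualDistrib k _ _ (ev k g ⊗ₜ counit k E) ∘ₗ comul k E = ev k g from
    LinearMap.congr_fun h c
  refine hom_ext' fun x y φ => ?_
  rw [LinearMap.comp_apply, comul_incl, map_sum]
  simp only [dualDistrib_map]
  have hc : ∀ b, counit k E ∘ₗ incl k b y = ev k (𝟙 y) ∘ₗ incl k b y := by
    intro b
    ext φ
    by_cases hb : b = y
    · subst hb; simp [counit_incl, ev_incl]
    · simp [counit_incl_ne hb, ev_incl_ne (𝟙 y) φ (by simpa using hb)]
  simp only [hc, ← dualDistrib_map]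
  rw [← map_sum, ← comul_incl]
  by_cases hx : w = y
  · subst hx
    rw [ev_ev_comul, Category.comp_id]
  · rw [ev_ev_comul_ne _ _ hx, ev_incl_ne _ _ (by simp [Ne.symm hx])]

theorem rTensor_counit_comp_comul :
    (counit k E).rTensor _ ∘ₗ comul k E = TensorProduct.mk k _ _ 1 := by
  refine LinearMap.ext fun c => (TensorProduct.lid k _).injective ?_
  rw [← sub_eq_zero]
  refine eq_zero_of_ev _ ?_
  rintro ⟨⟨x, y⟩, f⟩
  simp only at f
  rw [map_sub, sub_eq_zero, TensorProduct.mk_apply, TensorProduct.lid_tmul, one_smul]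
  simp only
  rw [← dualDistrib_counit_left f c, LinearMap.comp_apply]
  generalize comul k E c = s
  induction s with
  | zero => simp
  | add a b ha hb => simp only [map_add, ha, hb]
  | tmul a b => simp

theorem lTensor_counit_comp_comul :
    (counit k E).lTensor _ ∘ₗ comul k E = (TensorProduct.mk k _ _).flip 1 := by
  refine LinearMap.ext fun c => (TensorProduct.rid k _).injective ?_
  rw [← sub_eq_zero]
  refine eq_zero_of_ev _ ?_
  rintro ⟨⟨x, y⟩, f⟩
  simp only at f
  rw [map_sub, sub_eq_zero, LinearMap.flip_apply, TensorProduct.mk_apply,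
    TensorProduct.rid_tmul, one_smul]
  simp only
  rw [← dualDistrib_counit_right f c, LinearMap.comp_apply]
  generalize comul k E c = s
  induction s with
  | zero => simp
  | add a b ha hb => simp only [map_add, ha, hb]
  | tmul a b => simp [mul_comm]

end Axioms

/-- The coalgebra of a locally finite `k`-linear category. -/
instance (k : Type w) [Field k] (E : Type u) [Category.{v} E] [Preadditive E] [Linear k E]
    [IsLocallyFinite k E] : Coalgebra k (CatCoalg k E) where
  comul := comul k E
  counit := counit k E
  coassoc := comul_coassoc
  rTensor_counit_comp_comul := rTensor_counit_comp_comul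
  lTensor_counit_comp_comul := lTensor_counit_comp_comul

end CatCoalg

/-! ### The contramodule forgetful functor -/

section Theta

variable {k : Type w} [Field k] {E : Type u} [Category.{v} E] [Preadditive E] [Linear k E]
  [IsLocallyFinite k E]

/-- The action of a morphism `f : x ⟶ y` of `E` on a left contramodule `P`: an element `p` is
sent to the contraaction of the linear map `c ↦ c(f) • p`, which is supported on the summand
`Hom(x,y)^*` of the coalgebra. -/
def act (P : Contramodule.{w, max u v w, t} k (CatCoalg k E)) {x y : E} (f : x ⟶ y) :
    P →ₗ[k] P :=
  P.dualAct (CatCoalg.ev k f)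

theorem act_comp (P : Contramodule.{w, max u v w, t} k (CatCoalg k E)) {x y z : E} (f : x ⟶ y)
    (g : y ⟶ z) (p : P) : act P (f ≫ g) p = act P g (act P f p) := by
  let φ : CatCoalg k E →ₗ[k] CatCoalg k E →ₗ[k] P :=
    (CatCoalg.ev k g).smulRight ((CatCoalg.ev k f).smulRight p)
  have h1 : (CatCoalg.ev k g).smulRight (act P f p) = P.π ∘ₗ φ := by
    ext c
    simp [φ, act, Contramodule.dualAct]
  have h2 : (CatCoalg.ev k (f ≫ g)).smulRight p =
      TensorProduct.lift φ.flip ∘ₗ Coalgebra.comul := by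
    ext c
    rw [LinearMap.smulRight_apply, ← CatCoalg.ev_ev_comul, LinearMap.comp_apply]
    change _ = (TensorProduct.lift φ.flip) (CatCoalg.comul k E c)
    generalize CatCoalg.comul k E c = s
    induction s with
    | zero => simp
    | add a b ha hb => simp only [map_add, add_smul, ha, hb]
    | tmul a b => simp [φ, smul_smul, mul_comm]
  change P.π _ = P.π _
  rw [h1, h2, P.contraassoc]

theorem act_add (P : Contramodule.{w, max u v w, t} k (CatCoalg k E)) {x y : E} (f g : x ⟶ y)
    (p : P) : act P (f + g) p = act P f p + act P g p := by
  change P.π _ = P.π _ + P.π _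
  rw [← map_add]; congr 1; ext c; simp [CatCoalg.ev, add_smul]

theorem act_smul (P : Contramodule.{w, max u v w, t} k (CatCoalg k E)) {x y : E} (r : k)
    (f : x ⟶ y) (p : P) : act P (r • f) p = r • act P f p := by
  change P.π _ = r • P.π _
  rw [← map_smul]; congr 1; ext c; simp [CatCoalg.ev, mul_smul]

/-- The component `P^x` of a left contramodule: the image of the idempotent operator given by
the identity morphism of `x`. -/
def comp (P : Contramodule.{w, max u v w, t} k (CatCoalg k E)) (x : E) : Submodule k P :=
  LinearMap.range (act P (𝟙 x))

theorem act_mem (P : Contramodule.{w, max u v w, t} k (CatCoalg k E)) {x y : E} (f : x ⟶ y)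
    (p : P) : act P f p ∈ comp P y :=
  ⟨act P f p, by rw [← act_comp, Category.comp_id]⟩

theorem act_id (P : Contramodule.{w, max u v w, t} k (CatCoalg k E)) {x : E} {p : P}
    (hp : p ∈ comp P x) : act P (𝟙 x) p = p := by
  obtain ⟨q, rfl⟩ := hp
  rw [← act_comp, Category.comp_id]

theorem act_hom {P Q : Contramodule.{w, max u v w, t} k (CatCoalg k E)}
    (h : Contramodule.Hom P Q) {x y : E} (f : x ⟶ y) (p : P) :
    h.toLinearMap (act P f p) = act Q f (h.toLinearMap p) := by
  change h.toLinearMap (P.π _) = Q.π _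
  rw [h.comm]; congr 1; ext c; simp

/-- The left `E`-module of a left contramodule: `x ↦ P^x`, with `E` acting through `act`. -/
def thetaObj (P : Contramodule.{w, max u v w, t} k (CatCoalg k E)) : E ⥤ ModuleCat.{t} k where
  obj x := ModuleCat.of k (comp P x)
  map {x y} f := ModuleCat.ofHom
    (((act P f).domRestrict (comp P x)).codRestrict (comp P y) fun p => act_mem P f p)
  map_id x := by
    ext p
    exact act_id P p.2
  map_comp {x y z} f g := by
    ext p
    exact act_comp P f g p.1

instance (P : Contramodule.{w, max u v w, t} k (CatCoalg k E)) : (thetaObj P).Additive where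
  map_add {x y f g} := by
    ext p
    exact Subtype.ext (act_add P f g p.1)

instance (P : Contramodule.{w, max u v w, t} k (CatCoalg k E)) : (thetaObj P).Linear k where
  map_smul {x y} f r := by
    ext p
    exact Subtype.ext (act_smul P r f p.1)

variable (k E)

/-- The contramodule forgetful functor `Θ_E` from left contramodules over the coalgebra of `E`
to left `E`-modules. -/
def Theta : Contramodule.{w, max u v w, t} k (CatCoalg k E) ⥤ (E ⥤ ModuleCat.{t} k) where
  obj P := thetaObj P
  map {P Q} h :=
    { app := fun x => ModuleCat.ofHom
        ((Contramodule.Hom.toLinearMap h).restrict (p := comp P x) (q := comp Q x)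
          fun p hp => by
            rw [← act_id P hp, act_hom h]
            exact act_mem Q _ _)
      naturality := fun x y f => by
        ext p
        exact Subtype.ext (act_hom h f p.1) }
  map_id P := rfl
  map_comp f g := rfl

end Theta

/-! ### Left modules over a `k`-linear category -/

/-- The action map `Hom(x,y) ⊗ P(x) → P(y)` of a left `E`-module, that is, of a `k`-linear
functor `P` from `E` to `k`-vector spaces. -/
def actionMap (k : Type w) [Field k] {E : Type u} [Category.{v} E] [Preadditive E] [Linear k E]
    (P : E ⥤ ModuleCat.{t} k) [P.Additive] [P.Linear k] (x y : E) :
    (x ⟶ y) ⊗[k] P.obj x →ₗ[k] P.obj y :=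
  TensorProduct.lift
    ((ModuleCat.homLinearEquiv (S := k)).toLinearMap ∘ₗ P.mapLinearMap k)

end

end LocFin

/-! If only finitely many `x` act nontrivially into each `y`, the product of all `P(x)` becomes a
contramodule. A map from the coalgebra to the product restricts on each `Hom(x,y)^*` to an element
of `Hom(x,y) ⊗ P(x)`, since Hom spaces are finite-dimensional. Letting the morphisms act and summing
over the finitely many relevant `x` gives the `y`-coordinate (`piContraaction`). Contraassociativity
is functoriality of `P`, and the component of the product at `x` is `P(x)`.

Conversely, let a contramodule have finite-dimensional components. For each `y`, consider the
subspaces of the component at `y` spanned by the images of all morphisms from objects outside a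
finite set. By finite dimension there is a smallest one, `D(y)`, attained at some finite `S(y)`.
Discard also the finitely many objects equivalent to `y` and the sets `S(x)` for the finitely many
`x` in the frontier of `y`. The remaining morphisms into `y` factor through the frontier, so `D(y)`
lies in the sum of the images of the `D(x)` with `x ≺ y`.

A Nakayama lemma, `eq_bot_of_le_map_strictHom`, shows that such a `D` vanishes. An element `q` of
`D(y)` can be rewritten through strictly smaller objects again and again. Since intervals are
finite, all the stages together form one well-defined map from the coalgebra. Contraassociativity
equates the sum of all stages with the sum of all but the initial one, so `q = 0`. Hence every
object acting nontrivially into `y` lies in `S(y)`. -/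

namespace LocFin

noncomputable section

/-! ### Maps out of the coalgebra, summand by summand -/

namespace CatCoalg

section Desc

variable {k : Type w} [Field k] {E : Type u} [Category.{v} E] [Preadditive E] [Linear k E]

open scoped Classical in
/-- The linear map out of the coalgebra with prescribed restrictions to the summands. -/
def desc {M : Type*} [AddCommGroup M] [Module k M]
    (F : ∀ x y : E, Module.Dual k (x ⟶ y) →ₗ[k] M) : CatCoalg k E →ₗ[k] M :=
  (DirectSum.toModule k (E × E) M fun p => F p.1 p.2) ∘ₗ (toDirectSum k E).toLinearMap

theorem desc_incl {M : Type*} [AddCommGroup M] [Module k M]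
    (F : ∀ x y : E, Module.Dual k (x ⟶ y) →ₗ[k] M) (x y : E) (a : Module.Dual k (x ⟶ y)) :
    desc F (incl k x y a) = F x y a := by
  unfold desc incl
  rw [LinearMap.comp_apply, LinearMap.comp_apply, LinearEquiv.coe_coe, LinearEquiv.coe_coe,
    LinearEquiv.apply_symm_apply, DirectSum.toModule_lof]

variable [IsLocallyFinite k E]

open scoped Classical in
theorem lift_comul_incl {M : Type*} [AddCommGroup M] [Module k M]
    (φ : CatCoalg k E →ₗ[k] CatCoalg k E →ₗ[k] M) (x y : E) (c : Module.Dual k (x ⟶ y)) :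
    TensorProduct.lift φ (Coalgebra.comul (incl k x y c)) =
      ∑ z ∈ (IsLocallyFinite.finite_interval k x y).toFinset,
        TensorProduct.lift (φ.compl₁₂ (incl k x z) (incl k z y)) (comulComponent k x z y c) := by
  change TensorProduct.lift φ (comul k E (incl k x y c)) = _
  rw [comul_incl, map_sum]
  refine Finset.sum_congr rfl fun z _ => ?_
  rw [← LinearMap.comp_apply, TensorProduct.lift_comp_map]
  rfl

/-- Comultiplication is dual to composition, so the rank-one tensor of `f`, `g` and `m` pulls back
to that of `f ≫ g` and `m`. -/
theorem lift_comulComponent_rankOne {M : Type*} [AddCommGroup M] [Module k M] {x z y : E}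
    (f : x ⟶ z) (g : z ⟶ y) (m : M) (c : Module.Dual k (x ⟶ y)) :
    TensorProduct.lift ((Module.Dual.eval k _ f).smulRight ((Module.Dual.eval k _ g).smulRight m))
      (comulComponent k x z y c) = c (f ≫ g) • m := by
  rw [← dualDistrib_comulComponent]
  generalize comulComponent k x z y c = s
  induction s with
  | zero => simp
  | add a b ha hb => simp only [map_add, add_smul, ha, hb]
  | tmul a b => simp [smul_smul]

end Desc

end CatCoalg

/-! ### Contraction of maps out of a dual space -/

section Contract

variable {k : Type*} [Field k] {V W U : Type*} [AddCommGroup V] [Module k V] [Module.Finite k V]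
  [AddCommGroup W] [Module k W] [AddCommGroup U] [Module k U]

theorem dualHom_eq_sum (ψ : Module.Dual k V →ₗ[k] W) :
    ψ = ∑ i, (Module.Dual.eval k V (Module.finBasis k V i)).smulRight
      (ψ ((Module.finBasis k V).coord i)) := by
  refine LinearMap.ext fun a => ?_
  conv_lhs => rw [← (Module.finBasis k V).sum_dual_apply_smul_coord a]
  simp only [map_sum, map_smul, LinearMap.sum_apply, LinearMap.smulRight_apply,
    Module.Dual.eval_apply]

/-- Finite dimension of `V` identifies `Hom(V^*, W)` with `V ⊗ W`, so linear identities need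
checking only on pure tensors. -/
theorem dualHom_induction {motive : (Module.Dual k V →ₗ[k] W) → Prop} (zero : motive 0)
    (add : ∀ ψ χ, motive ψ → motive χ → motive (ψ + χ))
    (rankOne : ∀ v w, motive ((Module.Dual.eval k V v).smulRight w))
    (ψ : Module.Dual k V →ₗ[k] W) : motive ψ := by
  rw [dualHom_eq_sum ψ]
  exact Finset.sum_induction _ motive add zero fun i _ => rankOne _ _

/-- The map `Hom(V^*, W) ≃ V ⊗ W → U` induced by a bilinear map `V × W → U`. -/
def contract (L : V →ₗ[k] W →ₗ[k] U) : (Module.Dual k V →ₗ[k] W) →ₗ[k] U :=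
  ∑ i, L (Module.finBasis k V i) ∘ₗ LinearMap.applyₗ ((Module.finBasis k V).coord i)

theorem contract_rankOne (L : V →ₗ[k] W →ₗ[k] U) (v : V) (w : W) :
    contract L ((Module.Dual.eval k V v).smulRight w) = L v w := by
  conv_rhs => rw [← (Module.finBasis k V).sum_repr v, map_sum]
  simp [contract, LinearMap.sum_apply]

theorem contract_zero_left : contract (0 : V →ₗ[k] W →ₗ[k] U) = 0 := by
  simp [contract]

end Contract

/-! ### The product of the components of an `E`-module as a contramodule -/

section Product

variable {k : Type w} [Field k] {E : Type u} [Category.{v} E] [Preadditive E] [Linear k E]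
  (P : E ⥤ ModuleCat.{t} k) [P.Additive] [P.Linear k]

variable (k) in
/-- The action `Hom(x,y) → Hom(P(x), P(y))`. -/
def actHom (x y : E) : (x ⟶ y) →ₗ[k] P.obj x →ₗ[k] P.obj y :=
  (ModuleCat.homLinearEquiv (S := k)).toLinearMap ∘ₗ P.mapLinearMap k

theorem actHom_apply {x y : E} (f : x ⟶ y) (m : P.obj x) :
    actHom k P x y f m = (P.map f).hom m := rfl

theorem actHom_eq_zero {x y : E} (h : actionMap k P x y = 0) : actHom k P x y = 0 := by
  refine LinearMap.ext₂ fun f m => ?_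
  exact LinearMap.congr_fun h (f ⊗ₜ m)

theorem actionMap_eq_zero_iff {x y : E} :
    actionMap k P x y = 0 ↔ ∀ (f : x ⟶ y) (m : P.obj x), (P.map f).hom m = 0 := by
  refine ⟨fun h f m => LinearMap.congr_fun h (f ⊗ₜ m), fun h => ?_⟩
  exact TensorProduct.ext' fun f m => h f m

variable [IsLocallyFinite k E]

/-- This is contraassociativity for one triple `x, z, y`. On the pure tensor of `f`, `g` and `m` it
says that `f ≫ g` acts on `m` as `f` followed by `g`. -/
theorem contract_actHom_comul {x z y : E}
    (B : Module.Dual k (x ⟶ z) →ₗ[k] Module.Dual k (z ⟶ y) →ₗ[k] P.obj x) :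
    contract (actHom k P x y) (TensorProduct.lift B ∘ₗ CatCoalg.comulComponent k x z y) =
      contract (actHom k P z y) (contract (actHom k P x z) ∘ₗ B.flip) := by
  -- Both sides are packaged as linear maps in `B`, so that the reduction to pure tensors applies,
  -- once for each dual variable.
  let F : (Module.Dual k (x ⟶ z) →ₗ[k] Module.Dual k (z ⟶ y) →ₗ[k] P.obj x) →ₗ[k] P.obj y :=
    contract (actHom k P x y) ∘ₗ LinearMap.lcomp k _ (CatCoalg.comulComponent k x z y) ∘ₗ
      (TensorProduct.lift.equiv (.id k) _ _ _).toLinearMap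
  let G : (Module.Dual k (x ⟶ z) →ₗ[k] Module.Dual k (z ⟶ y) →ₗ[k] P.obj x) →ₗ[k] P.obj y :=
    contract (actHom k P z y) ∘ₗ LinearMap.compRight k (contract (actHom k P x z)) ∘ₗ
      LinearMap.lflip.toLinearMap
  change F B = G B
  induction B using dualHom_induction with
  | zero => rw [map_zero, map_zero]
  | add B C hB hC => rw [map_add, map_add, hB, hC]
  | rankOne f ψ =>
    let R : (Module.Dual k (z ⟶ y) →ₗ[k] P.obj x) →ₗ[k]
        (Module.Dual k (x ⟶ z) →ₗ[k] Module.Dual k (z ⟶ y) →ₗ[k] P.obj x) :=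
      LinearMap.smulRightₗ (Module.Dual.eval k (x ⟶ z) f)
    change F (R ψ) = G (R ψ)
    induction ψ using dualHom_induction with
    | zero => rw [map_zero, map_zero, map_zero]
    | add ψ χ h1 h2 => rw [map_add, map_add, map_add, h1, h2]
    | rankOne g m =>
      have e1 : TensorProduct.lift ((Module.Dual.eval k _ f).smulRight
          ((Module.Dual.eval k _ g).smulRight m)) ∘ₗ CatCoalg.comulComponent k x z y =
          (Module.Dual.eval k _ (f ≫ g)).smulRight m :=
        LinearMap.ext fun c => CatCoalg.lift_comulComponent_rankOne f g m c
      have e2 : contract (actHom k P x z) ∘ₗ ((Module.Dual.eval k _ f).smulRight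
          ((Module.Dual.eval k _ g).smulRight m)).flip =
          (Module.Dual.eval k _ g).smulRight ((P.map f).hom m) := by
        refine LinearMap.ext fun b => ?_
        have : ((Module.Dual.eval k (x ⟶ z) f).smulRight
          ((Module.Dual.eval k _ g).smulRight m)).flip b =
          (Module.Dual.eval k _ f).smulRight (b g • m) := by
          ext a; simp
        rw [LinearMap.comp_apply, this, contract_rankOne, map_smul]
        rfl
      refine (congrArg (contract (actHom k P x y)) e1).trans
        (Eq.trans ?_ (congrArg (contract (actHom k P z y)) e2).symm)
      rw [contract_rankOne, contract_rankOne]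
      simp [actHom_apply]

variable (hfin : ∀ y : E, {x : E | actionMap k P x y ≠ 0}.Finite)

/-- The contraaction on the product of the components. -/
def piContraaction : (CatCoalg k E →ₗ[k] ∀ x, P.obj x) →ₗ[k] ∀ x, P.obj x :=
  LinearMap.pi fun y => ∑ x ∈ (hfin y).toFinset, contract (actHom k P x y) ∘ₗ
    LinearMap.lcomp k _ (CatCoalg.incl k x y) ∘ₗ
    LinearMap.compRight k (LinearMap.proj x : (∀ x, P.obj x) →ₗ[k] P.obj x)

theorem piContraaction_apply (φ : CatCoalg k E →ₗ[k] ∀ x, P.obj x) (y : E) :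
    piContraaction P hfin φ y = ∑ x ∈ (hfin y).toFinset,
      contract (actHom k P x y) (LinearMap.proj x ∘ₗ φ ∘ₗ CatCoalg.incl k x y) := by
  rw [piContraaction, LinearMap.pi_apply, LinearMap.sum_apply]
  rfl

theorem contract_actHom_eq_zero {x y : E} (h : x ∉ (hfin y).toFinset)
    (ψ : Module.Dual k (x ⟶ y) →ₗ[k] P.obj x) : contract (actHom k P x y) ψ = 0 := by
  rw [actHom_eq_zero P (by simpa using h), contract_zero_left, LinearMap.zero_apply]

/-- If `x` is outside the finite index set, the single term is absent from the sum, but it is zero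
anyway. -/
theorem piContraaction_eq_single {φ : CatCoalg k E →ₗ[k] ∀ x, P.obj x} {x y : E}
    {ψ : Module.Dual k (x ⟶ y) →ₗ[k] P.obj x}
    (hψ : LinearMap.proj x ∘ₗ φ ∘ₗ CatCoalg.incl k x y = ψ)
    (h : ∀ x', x' ≠ x → φ ∘ₗ CatCoalg.incl k x' y = 0) :
    piContraaction P hfin φ y = contract (actHom k P x y) ψ := by
  rw [piContraaction_apply, Finset.sum_eq_single x, hψ]
  · intro x' _ hx'
    rw [h x' hx', LinearMap.comp_zero, map_zero]
  · exact fun hx => contract_actHom_eq_zero P hfin hx _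

theorem piContraaction_unit (p : ∀ x, P.obj x) :
    piContraaction P hfin ((Coalgebra.counit : CatCoalg k E →ₗ[k] k).smulRight p) = p := by
  funext y
  rw [piContraaction_eq_single P hfin (ψ := (Module.Dual.eval k _ (𝟙 y)).smulRight (p y)),
    contract_rankOne]
  · simp [actHom_apply]
  · refine LinearMap.ext fun a => ?_
    change (CatCoalg.counit k E (CatCoalg.incl k y y a) • p) y = a (𝟙 y) • p y
    rw [CatCoalg.counit_incl]; rfl
  · refine fun x hx => LinearMap.ext fun a => ?_
    change CatCoalg.counit k E (CatCoalg.incl k x y a) • p = 0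
    rw [CatCoalg.counit_incl_ne hx, zero_smul]

/-- Both sides are double sums of the same terms `T x z`, over different finite index sets. Each
term vanishes off either index set, so the sums agree. -/
theorem piContraaction_assoc (φ : CatCoalg k E →ₗ[k] CatCoalg k E →ₗ[k] ∀ x, P.obj x) :
    piContraaction P hfin (piContraaction P hfin ∘ₗ φ) =
      piContraaction P hfin (TensorProduct.lift φ.flip ∘ₗ Coalgebra.comul) := by
  classical
  funext y
  let B (x z : E) : Module.Dual k (x ⟶ z) →ₗ[k] Module.Dual k (z ⟶ y) →ₗ[k] P.obj x :=
    (φ.flip.compl₁₂ (CatCoalg.incl k x z) (CatCoalg.incl k z y)).compr₂ (LinearMap.proj x)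
  let T (x z : E) : P.obj y :=
    contract (actHom k P z y) (contract (actHom k P x z) ∘ₗ (B x z).flip)
  have hT (x z : E) : T x z =
      contract (actHom k P x y) (TensorProduct.lift (B x z) ∘ₗ CatCoalg.comulComponent k x z y) :=
    (contract_actHom_comul P (B x z)).symm
  have h1 (x z : E) (h : x ∉ (hfin y).toFinset) : T x z = 0 := by
    rw [hT]; exact contract_actHom_eq_zero P hfin h _
  have h2 (x z : E) (h : z ∉ (hfin y).toFinset) : T x z = 0 := contract_actHom_eq_zero P hfin h _
  have h3 (x z : E) (h : x ∉ (hfin z).toFinset) : T x z = 0 := by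
    have : contract (actHom k P x z) ∘ₗ (B x z).flip = 0 :=
      LinearMap.ext fun b => contract_actHom_eq_zero P hfin h _
    simp only [T]
    rw [this, map_zero]
  -- Outside the interval, `Hom(x,z)` or `Hom(z,y)` is zero, and so is the corresponding action map.
  have h4 (x z : E) (h : z ∉ (IsLocallyFinite.finite_interval k x y).toFinset) : T x z = 0 := by
    by_contra hne
    refine h ((Set.Finite.mem_toFinset _).2 ⟨?_, ?_⟩)
    · refine Relation.TransGen.single ?_
      by_contra! h0
      refine hne (h3 x z ?_)
      simp [actionMap_eq_zero_iff, h0]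
    · refine Relation.TransGen.single ?_
      by_contra! h0
      refine hne (h2 x z ?_)
      simp [actionMap_eq_zero_iff, h0]
  have hl : piContraaction P hfin (piContraaction P hfin ∘ₗ φ) y =
      ∑ z ∈ (hfin y).toFinset, ∑ x ∈ (hfin z).toFinset, T x z := by
    rw [piContraaction_apply]
    refine Finset.sum_congr rfl fun z _ => ?_
    simp only [T]
    rw [← map_sum]
    congr 1
    refine LinearMap.ext fun b => ?_
    rw [LinearMap.sum_apply]
    exact piContraaction_apply P hfin (φ (CatCoalg.incl k z y b)) z
  have hr : piContraaction P hfin (TensorProduct.lift φ.flip ∘ₗ Coalgebra.comul) y =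
      ∑ x ∈ (hfin y).toFinset,
        ∑ z ∈ (IsLocallyFinite.finite_interval k x y).toFinset, T x z := by
    rw [piContraaction_apply]
    refine Finset.sum_congr rfl fun x _ => ?_
    simp only [hT]
    rw [← map_sum]
    congr 1
    refine LinearMap.ext fun c => ?_
    rw [LinearMap.sum_apply, LinearMap.comp_apply, LinearMap.comp_apply, LinearMap.comp_apply,
      CatCoalg.lift_comul_incl, map_sum]
    refine Finset.sum_congr rfl fun z _ => ?_
    rw [← LinearMap.comp_apply, ← TensorProduct.lift_compr₂]
    rfl
  rw [hl, hr]
  -- The inner index set is changed by passing through the union of the two sets, where the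
  -- additional terms are zero.
  have hl' : ∑ z ∈ (hfin y).toFinset, ∑ x ∈ (hfin z).toFinset, T x z =
      ∑ z ∈ (hfin y).toFinset, ∑ x ∈ (hfin y).toFinset, T x z := by
    refine Finset.sum_congr rfl fun z _ => ?_
    rw [Finset.sum_subset (Finset.subset_union_left (s₂ := (hfin y).toFinset))
      fun x _ hx => h3 x z hx]
    exact (Finset.sum_subset Finset.subset_union_right fun x _ hx => h1 x z hx).symm
  rw [hl', Finset.sum_comm]
  refine Finset.sum_congr rfl fun x _ => ?_
  rw [Finset.sum_subset (Finset.subset_union_left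
      (s₂ := (IsLocallyFinite.finite_interval k x y).toFinset)) fun z _ hz => h2 x z hz]
  exact (Finset.sum_subset Finset.subset_union_right fun z _ hz => h4 x z hz).symm

end Product

/-! ### Recovering the module from its product contramodule -/

section ProductContramodule

variable {k : Type w} [Field k] {E : Type u} [Category.{v} E] [Preadditive E] [Linear k E]
  [IsLocallyFinite k E] (P : E ⥤ ModuleCat.{max u t} k) [P.Additive] [P.Linear k]
  (hfin : ∀ y : E, {x : E | actionMap k P x y ≠ 0}.Finite)

/-- The product of the components of an `E`-module, as a left contramodule. -/
def piContramodule : Contramodule.{w, max u v w, max u t} k (CatCoalg k E) where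
  carrier := ∀ x, P.obj x
  π := piContraaction P hfin
  contraassoc := piContraaction_assoc P hfin
  contraunit := piContraaction_unit P hfin

open scoped Classical in
theorem act_piContramodule {x y : E} (f : x ⟶ y) (p : ∀ x, P.obj x) :
    act (piContramodule.{w, u, v, t} P hfin) f p = Pi.single y ((P.map f).hom (p x)) := by
  change piContraaction P hfin ((CatCoalg.ev k f).smulRight p) = _
  funext y'
  by_cases hy : y' = y
  · subst hy
    rw [piContraaction_eq_single P hfin (ψ := (Module.Dual.eval k _ f).smulRight (p x)),
      contract_rankOne, Pi.single_eq_same, actHom_apply]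
    · refine LinearMap.ext fun a => ?_
      change (CatCoalg.ev k f (CatCoalg.incl k x y' a) • p) x = a f • p x
      rw [CatCoalg.ev_incl]; rfl
    · refine fun x' hx => LinearMap.ext fun a => ?_
      change CatCoalg.ev k f (CatCoalg.incl k x' y' a) • p = 0
      rw [CatCoalg.ev_incl_ne _ _ (by simp [hx]), zero_smul]
  · rw [Pi.single_eq_of_ne hy, piContraaction_apply]
    refine Finset.sum_eq_zero fun x' _ => ?_
    convert map_zero (contract (actHom k P x' y'))
    refine LinearMap.ext fun a => ?_
    change (CatCoalg.ev k f (CatCoalg.incl k x' y' a) • p) x' = 0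
    rw [CatCoalg.ev_incl_ne _ _ (by simp [hy]), zero_smul]; rfl

open scoped Classical in
theorem mem_comp_piContramodule {x : E} {p : ∀ x, P.obj x} :
    p ∈ comp (piContramodule.{w, u, v, t} P hfin) x ↔ Pi.single x (p x) = p := by
  have h (q : ∀ x, P.obj x) : act (piContramodule.{w, u, v, t} P hfin) (𝟙 x) q =
      Pi.single x (q x) := by
    rw [act_piContramodule, P.map_id]; rfl
  constructor
  · rintro ⟨q, hq⟩
    have hq' : p = Pi.single x (q x) := hq.symm.trans (h q)
    rw [hq', Pi.single_eq_same]
  · exact fun hp => ⟨p, (h p).trans hp⟩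

open scoped Classical in
/-- The component of the product contramodule at `x` is `P(x)`. -/
def compPiEquiv (x : E) : comp (piContramodule.{w, u, v, t} P hfin) x ≃ₗ[k] P.obj x where
  toFun p := (show ∀ x, P.obj x from p.1) x
  map_add' _ _ := rfl
  map_smul' _ _ := rfl
  invFun m := ⟨(Pi.single x m : ∀ x, P.obj x), (mem_comp_piContramodule P hfin).2 (by simp)⟩
  left_inv p := Subtype.ext ((mem_comp_piContramodule P hfin).1 p.2)
  right_inv m := Pi.single_eq_same (M := fun x => P.obj x) x m

/-- The `E`-module of the product contramodule is the original module. -/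
def thetaPiIso : thetaObj (piContramodule.{w, u, v, t} P hfin) ≅ P :=
  NatIso.ofComponents (fun x => (compPiEquiv P hfin x).toModuleIso) fun {x y} f => by
    classical
    refine ModuleCat.hom_ext (LinearMap.ext fun p => ?_)
    refine (congrFun (act_piContramodule P hfin f p.1) y).trans ?_
    rw [Pi.single_eq_same]
    rfl

end ProductContramodule

/-! ### A Nakayama lemma for contramodules over the coalgebra of a category -/

section Nakayama

variable {E : Type u} [Category.{v} E] [Preadditive E]

/-- `≼` is not reflexive at zero objects, but a nonzero morphism out of `x` forces `𝟙 x ≠ 0`. -/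
theorem Le.refl_left {x y : E} (h : Le x y) : Le x x := by
  have hx : ∃ (z : E) (f : x ⟶ z), f ≠ 0 := by
    induction h using Relation.TransGen.head_induction_on with
    | single h => exact ⟨_, h⟩
    | head h _ _ => exact ⟨_, h⟩
  obtain ⟨z, f, hf⟩ := hx
  refine Relation.TransGen.single ⟨𝟙 x, fun h0 => hf ?_⟩
  rw [← Category.id_comp f, h0, Limits.zero_comp]

/-- Moving up from `x` to `z` shrinks the finite interval below `y`: it loses `x` itself. -/
theorem wellFounded_lt_le (k : Type w) [Field k] [Linear k E] [IsLocallyFinite k E] (y : E) : WellFounded fun z x : E => Lt x z ∧ Le z y := by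
  refine Subrelation.wf (r := InvImage (· < ·) fun x : E => {z : E | Le x z ∧ Le z y}.ncard)
    ?_ (InvImage.wf _ wellFounded_lt)
  rintro z x ⟨hxz, hzy⟩
  refine Set.ncard_lt_ncard ?_ (IsLocallyFinite.finite_interval k x y)
  refine ⟨fun a ha => ⟨hxz.1.trans ha.1, ha.2⟩, fun h => hxz.2 ?_⟩
  exact (h ⟨hxz.1.refl_left, hxz.1.trans hzy⟩ : _ ∧ _).1

variable {k : Type w} [Field k] [Linear k E] [IsLocallyFinite k E]

open scoped Classical in
-- Well-founded recursion on the source `x`, with the target `y` fixed: the value at `x` uses only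
-- values at `z` with `x ≺ z ≼ y`.
theorem exists_recursive_family {A : E → E → Type*} [∀ x y, AddCommMonoid (A x y)]
    (b : ∀ x y, A x y) (G : ∀ x z y, A z y → A x y) :
    ∃ S : ∀ x y, A x y, ∀ x y, S x y = b x y +
      ∑ z ∈ (IsLocallyFinite.finite_interval k x y).toFinset,
        if Lt x z then G x z y (S z y) else 0 := by
  let F (y x : E) (S : ∀ z, Lt x z ∧ Le z y → A z y) : A x y := b x y +
      ∑ z ∈ (IsLocallyFinite.finite_interval k x y).toFinset,
        if h : Lt x z ∧ Le z y then G x z y (S z h) else 0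
  refine ⟨fun x y => (wellFounded_lt_le k y).fix (F y) x, fun x y => ?_⟩
  refine (WellFounded.fix_eq _ (F y) x).trans ?_
  change _ + _ = _
  congr 1
  refine Finset.sum_congr rfl fun z hz => ?_
  have hz : Le z y := ((Set.Finite.mem_toFinset _).1 hz).2
  simp only [hz, and_true]
  split_ifs <;> rfl

variable (P : Contramodule.{w, max u v w, t} k (CatCoalg k E))

/-- The maps from the coalgebra to a contramodule that are supported on the summands `Hom(x,z)^*`
with `x ≺ z`, and take values in `D(x)` there. -/
def strictHom (D : E → Submodule k P) (z : E) : Submodule k (CatCoalg k E →ₗ[k] P) where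
  carrier := {ψ | ∀ x y a, ψ (CatCoalg.incl k x y a) ∈ D x ∧
    (¬ (y = z ∧ Lt x z) → ψ (CatCoalg.incl k x y a) = 0)}
  add_mem' h1 h2 x y a :=
    ⟨add_mem (h1 x y a).1 (h2 x y a).1, fun h => by
      rw [LinearMap.add_apply, (h1 x y a).2 h, (h2 x y a).2 h, add_zero]⟩
  zero_mem' x y a := ⟨zero_mem _, fun _ => rfl⟩
  smul_mem' r ψ h x y a :=
    ⟨Submodule.smul_mem _ r (h x y a).1, fun hh => by
      rw [LinearMap.smul_apply, (h x y a).2 hh, smul_zero]⟩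

theorem ev_smulRight_mem_strictHom {D : E → Submodule k P} {x z : E} (h : Lt x z) (f : x ⟶ z)
    {p : P} (hp : p ∈ D x) : (CatCoalg.ev k f).smulRight p ∈ strictHom P D z := by
  intro x' y a
  rw [LinearMap.smulRight_apply]
  by_cases hxy : x' = x ∧ y = z
  · obtain ⟨rfl, rfl⟩ := hxy
    exact ⟨Submodule.smul_mem _ _ hp, fun h' => absurd ⟨rfl, h⟩ h'⟩
  · rw [CatCoalg.ev_incl_ne f a hxy, zero_smul]
    exact ⟨zero_mem _, fun _ => rfl⟩

/-- Over a field, preimages in `N` of elements of `D` can be chosen linearly, and the choice extends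
to all of `W`. -/
theorem exists_linear_section {V W : Type*} [AddCommGroup V] [Module k V] [AddCommGroup W]
    [Module k W] (f : V →ₗ[k] W) (N : Submodule k V) (D : Submodule k W) (h : D ≤ N.map f) :
    ∃ σ : W →ₗ[k] V, (∀ w, σ w ∈ N) ∧ ∀ w ∈ D, f (σ w) = w := by
  obtain ⟨τ, hτ⟩ := (f.submoduleMap N).exists_rightInverse_of_surjective
    (LinearMap.range_eq_top.2 (f.submoduleMap_surjective N))
  obtain ⟨ρ, hρ⟩ := (τ ∘ₗ Submodule.inclusion h).exists_extend
  refine ⟨N.subtype ∘ₗ ρ, fun w => (ρ w).2, fun w hw => ?_⟩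
  have h1 : ρ w = τ ⟨w, h hw⟩ := LinearMap.congr_fun hρ ⟨w, hw⟩
  have h2 := congrArg Subtype.val (LinearMap.congr_fun hτ ⟨w, h hw⟩)
  simp only [LinearMap.comp_apply, Submodule.subtype_apply, h1]
  exact h2

/-- Starting from `q`, each element of `D(z)` is repeatedly replaced by a chosen preimage under `π`
supported on sources `x ≺ z`. The sum of all these stages is finite on each summand of the
coalgebra, and contraassociativity cancels everything except `q`. -/
theorem eq_bot_of_le_map_strictHom (D : E → Submodule k P) (hD : ∀ y, D y ≤ comp P y)
    (h : ∀ y, D y ≤ (strictHom P D y).map P.π) (y : E) : D y = ⊥ := by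
  classical
  choose σ hσ hσπ using fun z => exists_linear_section P.π (strictHom P D z) (D z) (h z)
  rw [eq_bot_iff]
  intro q hq
  let ψ : CatCoalg k E →ₗ[k] P := (CatCoalg.ev k (𝟙 y)).smulRight q
  -- `S` is the sum of all stages: the initial stage `ψ`, plus the result of applying `σ` to `S`
  -- itself and comultiplying.
  obtain ⟨S, hS⟩ := exists_recursive_family (k := k)
    (A := fun x y : E => Module.Dual k (x ⟶ y) →ₗ[k] P)
    (fun x y => ψ ∘ₗ CatCoalg.incl k x y)
    (fun x z y s => TensorProduct.lift
      ((LinearMap.lcomp k _ (CatCoalg.incl k x z) ∘ₗ σ z ∘ₗ s).flip) ∘ₗ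
        CatCoalg.comulComponent k x z y)
  have hψD (x y') (a : Module.Dual k (x ⟶ y')) : ψ (CatCoalg.incl k x y' a) ∈ D x := by
    by_cases hx : x = y ∧ y' = y
    · obtain ⟨rfl, rfl⟩ := hx
      exact Submodule.smul_mem _ _ hq
    · simp only [ψ, LinearMap.smulRight_apply]
      rw [CatCoalg.ev_incl_ne _ _ hx, zero_smul]
      exact zero_mem _
  have hSD (x y') (a : Module.Dual k (x ⟶ y')) : S x y' a ∈ D x := by
    rw [hS, LinearMap.add_apply, LinearMap.sum_apply]
    refine add_mem (hψD x y' a) (sum_mem fun z _ => ?_)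
    split_ifs
    · rw [LinearMap.comp_apply]
      generalize CatCoalg.comulComponent k x z y' a = s
      induction s with
      | zero => simp
      | add s t hs ht => rw [map_add]; exact add_mem hs ht
      | tmul a b => exact (hσ z (S z y' b) x z a).1
    · exact zero_mem _
  let φ : CatCoalg k E →ₗ[k] CatCoalg k E →ₗ[k] P := CatCoalg.desc fun z y' => σ z ∘ₗ S z y'
  have hφ : P.π ∘ₗ φ = CatCoalg.desc S := by
    refine CatCoalg.hom_ext' fun z y' b => ?_
    rw [LinearMap.comp_apply, CatCoalg.desc_incl, CatCoalg.desc_incl]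
    exact hσπ z _ (hSD z y' b)
  -- The comultiplication sums over the whole interval and the recursion only over `x ≺ z`; the
  -- other terms vanish because `σ z` takes values in `strictHom`.
  have hφ' : TensorProduct.lift φ.flip ∘ₗ Coalgebra.comul + ψ = CatCoalg.desc S := by
    refine CatCoalg.hom_ext' fun x y' c => ?_
    rw [CatCoalg.desc_incl, hS, LinearMap.add_apply, LinearMap.add_apply, add_comm,
      LinearMap.comp_apply, LinearMap.comp_apply, CatCoalg.lift_comul_incl, LinearMap.sum_apply]
    congr 1
    refine Finset.sum_congr rfl fun z _ => ?_
    have e : ∀ (a : Module.Dual k (x ⟶ z)) (b : Module.Dual k (z ⟶ y')),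
        φ.flip.compl₁₂ (CatCoalg.incl k x z) (CatCoalg.incl k z y') a b =
          σ z (S z y' b) (CatCoalg.incl k x z a) := fun a b => by
      rw [LinearMap.compl₁₂_apply, LinearMap.flip_apply]
      simp only [φ]
      rw [CatCoalg.desc_incl]
      rfl
    split_ifs with hxz
    · rw [LinearMap.comp_apply]
      congr 2
      exact LinearMap.ext₂ e
    · have : φ.flip.compl₁₂ (CatCoalg.incl k x z) (CatCoalg.incl k z y') = 0 :=
        LinearMap.ext₂ fun a b => by
          rw [e]; exact (hσ z (S z y' b) x z a).2 (by simp [hxz])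
      rw [this]
      exact LinearMap.congr_fun (map_zero (TensorProduct.lift.equiv (.id k) _ _ _)) _
  have hq0 : P.π ψ = q := act_id P (hD y hq)
  -- With `ψ'` denoting the later stages, this reads `π(ψ' + ψ) = π(ψ')`, hence `π ψ = 0`; and `π ψ`
  -- is `q`.
  have key := P.contraassoc φ
  rw [hφ, ← hφ', map_add, add_eq_left, hq0] at key
  exact (Submodule.mem_bot k).2 key

end Nakayama

/-! ### Finiteness of the action on contramodules with finite-dimensional components -/

section Finiteness

variable {k : Type w} [Field k] {E : Type u} [Category.{v} E] [Preadditive E] [Linear k E]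

section

variable [IsLocallyFinite k E] (P : Contramodule.{w, max u v w, t} k (CatCoalg k E))

/-- The span in `P^y` of the images of all `P^x` with `x ∉ S`. -/
def actSpan (y : E) (S : Set E) : Submodule k P :=
  Submodule.span k {q | ∃ x ∉ S, ∃ (f : x ⟶ y), ∃ p ∈ comp P x, act P f p = q}

theorem act_mem_actSpan {x y : E} {S : Set E} (hx : x ∉ S) (f : x ⟶ y) {p : P}
    (hp : p ∈ comp P x) : act P f p ∈ actSpan P y S :=
  Submodule.subset_span ⟨x, hx, f, p, hp, rfl⟩

theorem actSpan_le_comp (y : E) (S : Set E) : actSpan P y S ≤ comp P y := by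
  refine Submodule.span_le.2 ?_
  rintro _ ⟨x, -, f, p, -, rfl⟩
  exact act_mem P f p

theorem actSpan_anti (y : E) {S T : Set E} (h : S ⊆ T) : actSpan P y T ≤ actSpan P y S := by
  refine Submodule.span_mono ?_
  rintro _ ⟨x, hx, r⟩
  exact ⟨x, fun hxS => hx (h hxS), r⟩

/-- A finite `S` with span of minimal dimension works: enlarging `S` by `T` cannot shrink the span,
so it lies in the span for `T`. -/
theorem exists_actSpan_le (y : E) [Module.Finite k (comp P y)] :
    ∃ S : Set E, S.Finite ∧ ∀ T : Set E, T.Finite → actSpan P y S ≤ actSpan P y T := by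
  obtain ⟨S, hS, hmin⟩ := WellFounded.has_min
    (InvImage.wf (fun S : Set E => Module.finrank k (actSpan P y S)) wellFounded_lt)
    {S : Set E | S.Finite} ⟨∅, Set.finite_empty⟩
  refine ⟨S, hS, fun T hT => ?_⟩
  have hle := actSpan_anti P y (Set.subset_union_left (s := S) (t := T))
  have : Module.Finite k (actSpan P y S) :=
    Submodule.finiteDimensional_of_le (actSpan_le_comp P y S)
  rw [← Submodule.eq_of_le_of_finrank_le hle (not_lt.1 (hmin _ (hS.union hT)))]
  exact actSpan_anti P y Set.subset_union_right

end

variable [IsLeftStrictlyLocallyFinite k E] (P : Contramodule.{w, max u v w, t} k (CatCoalg k E))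

/-- The minimal spans satisfy the hypothesis of the Nakayama lemma, hence vanish; so nothing outside
the finite set `S y` acts nontrivially into `y`. -/
theorem finite_act_ne_zero (hP : ∀ x, Module.Finite k (comp P x)) (y : E) :
    {x : E | ∃ (f : x ⟶ y), ∃ p ∈ comp P x, act P f p ≠ 0}.Finite := by
  choose S hS hmin using fun y => exists_actSpan_le P y
  have hbot := eq_bot_of_le_map_strictHom P (fun y => actSpan P y (S y))
    (fun y => actSpan_le_comp P y _) ?_ y
  · refine (hS y).subset ?_
    rintro x ⟨f, p, hp, hne⟩
    by_contra hx
    refine hne ((Submodule.mem_bot k).1 ?_)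
    rw [← hbot]
    exact act_mem_actSpan P hx f hp
  · intro y
    obtain ⟨X, hX, hfac⟩ := IsLeftStrictlyLocallyFinite.exists_frontier (k := k) y
    -- Excluding the objects equivalent to `y` makes every remaining source of a nonzero morphism to
    -- `y` strictly smaller. Excluding `S x` for `x` in the frontier puts the intermediate elements
    -- into the minimal spans there.
    refine (hmin y ({z | Le y z ∧ Le z y} ∪ ⋃ x ∈ X, S x)
      ((IsLocallyFinite.finite_interval k y y).union
        (X.finite_toSet.biUnion fun x _ => hS x))).trans (Submodule.span_le.2 ?_)
    rintro _ ⟨x, hx, f, p, hp, rfl⟩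
    by_cases hf : f = 0
    · subst hf
      have : act P (0 : x ⟶ y) p = 0 := by simpa using act_smul P (0 : k) (0 : x ⟶ y) p
      rw [this]
      exact zero_mem _
    have hxy : Le x y := Relation.TransGen.single ⟨f, hf⟩
    obtain ⟨n, z, g, h, hz, rfl⟩ := hfac x f ⟨hxy, fun hyx => hx (Or.inl ⟨hyx, hxy⟩)⟩
    let L : (x ⟶ y) →+ P := AddMonoidHom.mk' (fun f => act P f p) fun f g => act_add P f g p
    have hL : act P (∑ i, g i ≫ h i) p = ∑ i, act P (g i ≫ h i) p := map_sum L _ _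
    rw [hL]
    refine sum_mem fun i _ => ?_
    rw [act_comp]
    -- The preimage under `π` is the functional `c ↦ c(h i)` times the element that `g i` produces
    -- from `p`.
    refine ⟨_, ev_smulRight_mem_strictHom P (hX _ (hz i)) (h i) (act_mem_actSpan P ?_ (g i) hp),
      rfl⟩
    exact fun hxS => hx (Or.inr (Set.mem_biUnion (hz i) hxS))

end Finiteness

end

end LocFin

/-! ### The criterion for the essential image -/

theorem mainTheorem2 (k : Type w) [Field k] (E : Type u) [Category.{v} E]
    [Preadditive E] [Linear k E] [LocFin.IsLeftStrictlyLocallyFinite k E]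
    (P : E ⥤ ModuleCat.{max u t} k) [P.Additive] [P.Linear k]
    (hP : ∀ x : E, Module.Finite k (P.obj x)) :
    (LocFin.Theta.{w, u, v, max u t} k E).essImage P ↔
      ∀ y : E, {x : E | LocFin.actionMap k P x y ≠ 0}.Finite := by
  constructor
  · rintro ⟨Q, ⟨e⟩⟩ y
    have hQ (x : E) : Module.Finite k (LocFin.comp Q x) :=
      Module.Finite.equiv (e.app x).toLinearEquiv.symm
    refine (LocFin.finite_act_ne_zero Q hQ y).subset fun x hx => ?_
    by_contra hne
    refine hx ((LocFin.actionMap_eq_zero_iff P).2 fun f m => ?_)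
    -- Vanishing of the action of `f` is transported from the components of `Q` to `P` by naturality
    -- of the isomorphism.
    have hm : m = (e.hom.app x).hom ((e.inv.app x).hom m) :=
      ((e.app x).toLinearEquiv.apply_symm_apply m).symm
    have hnat := LinearMap.congr_fun (congrArg ModuleCat.Hom.hom (e.hom.naturality f))
      ((e.inv.app x).hom m)
    have h0 : (((LocFin.Theta k E).obj Q).map f).hom ((e.inv.app x).hom m) = 0 := by
      refine Subtype.ext ?_
      by_contra h
      exact hne ⟨f, _, ((e.inv.app x).hom m).2, h⟩
    rw [hm]
    refine hnat.symm.trans ?_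
    rw [ModuleCat.hom_comp, LinearMap.comp_apply, h0, map_zero]
  · intro hfin
    exact ⟨LocFin.piContramodule.{w, u, v, t} P hfin, ⟨LocFin.thetaPiIso.{w, u, v, t} P hfin⟩⟩
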